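/- Let $\mathbb D=\{z\in\mathbb C:|z|<1\}$ and let $dm=\frac1\pi\,dx\,dy$ be the normalized area measure. For an arc $I\subset\partial\mathbb D$ of normalized arc length $|I|=\frac1{2\pi}\int_I|d\zeta|\in(0,1]$, let $S(I)=\{z\in\mathbb D: 1-|I|\le |z|<1,\ z/|z|\in I\}$ be the Carleson box based on $I$ (with $S(\partial\mathbb D)=\mathbb D$). For $0<\lambda\le 1$ and $p>1$, the Bloch–Morrey type space $B\mathcal L^{p,\lambda}$ is the set of all functions $g$ analytic on $\mathbb D$ such that $$\sup_{I\subset\partial\mathbb D}\left(\frac1{|I|^{p-\lambda+1}}\int_{S(I)}|g'(z)|^2(1-|z|^2)^p\,dm(z)\right)^{1/2}<\infty .$$ If $0<\lambda<1$ and $1<p<q<\infty$, then $B\mathcal L^{p,\lambda}=B\mathcal L^{q,\lambda}$. -/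

import Mathlib

open MeasureTheory Set
open scoped ENNReal

noncomputable section

namespace BlochMorrey

/-- The closed arc of the unit circle centred at `exp (i c)` and of normalized arc length
`l` (arc length divided by `2 * π`), for `0 < l ≤ 1`; for `l = 1` it is the whole circle. -/
def arc (c l : ℝ) : Set ℂ :=
  {ζ | ∃ θ : ℝ, |θ - c| ≤ Real.pi * l ∧ ζ = Complex.exp (θ * Complex.I)}

/-- The Carleson box over a set `A` of the unit circle of normalized length `l`:
the points `z` with `1 - l ≤ |z| < 1` and `z / |z| ∈ A`. The last condition is written as
`z = |z| * ζ` with `ζ ∈ A`, so that the box over the whole circle is the whole disc,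
with its centre. -/
def carlesonBox (A : Set ℂ) (l : ℝ) : Set ℂ :=
  {z | 1 - l ≤ ‖z‖ ∧ ‖z‖ < 1 ∧ ∃ ζ ∈ A, z = (‖z‖ : ℂ) * ζ}

/-- The normalized area measure `dm = dx dy / π`. -/
def area : Measure ℂ := ENNReal.ofReal (1 / Real.pi) • (volume : Measure ℂ)

/-- The supremum over all arcs `I` of
`(|I| ^ (-(p - lam + 1)) * ∫_{S(I)} |g'(z)|² (1 - |z|²) ^ p dm(z)) ^ (1 / 2)`,
as an extended nonnegative real number. -/
def seminorm (p lam : ℝ) (g : ℂ → ℂ) : ℝ≥0∞ :=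
  ⨆ (c : ℝ) (l : ℝ) (_ : 0 < l ∧ l ≤ 1),
    (ENNReal.ofReal (1 / l ^ (p - lam + 1)) *
      ∫⁻ z in carlesonBox (arc c l) l,
        ENNReal.ofReal (‖deriv g z‖ ^ 2 * (1 - ‖z‖ ^ 2) ^ p) ∂area) ^ (1 / 2 : ℝ)

/-- The Bloch–Morrey type space: the functions `g` analytic on the open unit disc
with finite seminorm. Only the values of `g` on the open unit disc play a role. -/
def space (p lam : ℝ) : Set (ℂ → ℂ) :=
  {g | AnalyticOnNhd ℂ g (Metric.ball 0 1) ∧ seminorm p lam g < ∞}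

end BlochMorrey

end

namespace BlochMorrey

/-! For `lam < p`, membership in `space p lam` is equivalent to the growth condition `|g'(z)|² ≤ C
(1 - |z|) ^ (-(1 + lam))`, in which `p` does not occur. Necessity (`norm_deriv_sq_le_of_mem_space`):
a disc about `z` of radius comparable to `1 - |z|` lies in a Carleson box of comparable size, and
the sub-mean value property bounds `|g'(z)|²` by the box integral. Sufficiency
(`mem_space_of_norm_deriv_sq_le`): the growth bound leaves `(1 - |z|) ^ (p - lam - 1)` to integrate
over the box, which converges and gives the power `l ^ (p - lam + 1)`. -/

theorem lintegral_eq_lintegral_polar {F : ℂ → ℝ≥0∞} (hF : Measurable F) :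
    ∫⁻ z, F z = ∫⁻ r in Ioi (0 : ℝ), ENNReal.ofReal r *
      ∫⁻ θ in Ioo (-Real.pi) Real.pi, F (r * Complex.exp (θ * Complex.I)) := by
  have hm : Measurable fun p : ℝ × ℝ => F (p.1 * Complex.exp (p.2 * Complex.I)) := by fun_prop
  rw [← Complex.lintegral_comp_polarCoord_symm, polarCoord_target, Measure.volume_eq_prod,
    ← Measure.prod_restrict]
  simp only [Complex.polarCoord_symm_apply, Complex.ofReal_cos, Complex.ofReal_sin,
    ← Complex.exp_mul_I, smul_eq_mul]
  rw [lintegral_prod _ (by fun_prop)]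
  refine lintegral_congr fun r => ?_
  have hr : Measurable fun θ : ℝ => F (r * Complex.exp (θ * Complex.I)) := by fun_prop
  exact lintegral_const_mul (ENNReal.ofReal r) hr

theorem enorm_mul_two_pi_le_lintegral_circle {h : ℂ → ℂ} {c : ℂ} {r R : ℝ} (hr : 0 < r)
    (hrR : r < R) (hh : DifferentiableOn ℂ h (Metric.ball c R)) :
    ENNReal.ofReal (2 * Real.pi) * ‖h c‖ₑ ≤
      ∫⁻ θ in Ioo (-Real.pi) Real.pi, ‖h (c + r * Complex.exp (θ * Complex.I))‖ₑ := by
  have hd : DiffContOnCl ℂ h (Metric.ball c |r|) := by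
    refine (hh.mono ?_).diffContOnCl
    rw [abs_of_pos hr, closure_ball _ hr.ne']
    exact Metric.closedBall_subset_ball hrR
  have hper : Function.Periodic (fun θ : ℝ => h (circleMap c r θ)) (2 * Real.pi) := fun θ => by
    simp only [periodic_circleMap c r θ]
  have key : ((2 * Real.pi : ℝ) : ℂ) * h c =
      ∫ θ in Ioc (-Real.pi) Real.pi, h (c + r * Complex.exp (θ * Complex.I)) := by
    have h1 := hd.circleAverage
    rw [Real.circleAverage_def] at h1
    have h2 := hper.intervalIntegral_add_eq 0 (-Real.pi)
    rw [zero_add, show -Real.pi + 2 * Real.pi = Real.pi by ring] at h2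
    rw [← h1, h2, intervalIntegral.integral_of_le (by linarith [Real.pi_pos]),
      Complex.real_smul, ← mul_assoc, ← Complex.ofReal_mul,
      mul_inv_cancel₀ Real.two_pi_pos.ne', Complex.ofReal_one, one_mul]
    rfl
  calc ENNReal.ofReal (2 * Real.pi) * ‖h c‖ₑ = ‖((2 * Real.pi : ℝ) : ℂ) * h c‖ₑ := by
        rw [enorm_mul, ← ofReal_norm ((2 * Real.pi : ℝ) : ℂ), Complex.norm_real,
          Real.norm_of_nonneg Real.two_pi_pos.le]
    _ ≤ _ := by
        rw [key, restrict_Ioo_eq_restrict_Ioc]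
        exact enorm_integral_le_lintegral_enorm _

theorem lintegral_Ioo_ofReal {R : ℝ} (hR : 0 ≤ R) :
    ∫⁻ r in Ioo 0 R, ENNReal.ofReal r = ENNReal.ofReal (R ^ 2 / 2) := by
  rw [restrict_Ioo_eq_restrict_Ioc, ← ofReal_integral_eq_lintegral_ofReal,
    ← intervalIntegral.integral_of_le hR, integral_id]
  · simp
  · exact (intervalIntegrable_iff_integrableOn_Ioc_of_le hR).1 intervalIntegral.intervalIntegrable_id
  · filter_upwards [ae_restrict_mem measurableSet_Ioc] with r hr using hr.1.le

/-- The area sub-mean value property of holomorphic functions. -/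
theorem enorm_mul_le_lintegral_ball {h : ℂ → ℂ} {c : ℂ} {R : ℝ} (hR : 0 < R)
    (hh : DifferentiableOn ℂ h (Metric.ball c R)) :
    ENNReal.ofReal (Real.pi * R ^ 2) * ‖h c‖ₑ ≤ ∫⁻ z in Metric.ball c R, ‖h z‖ₑ := by
  have hm : Measurable ((Metric.ball c R).indicator fun z => ‖h z‖ₑ) := by
    classical
    have : Measurable ((Metric.ball c R).piecewise h 0) :=
      hh.continuousOn.measurable_piecewise continuousOn_const measurableSet_ball
    have h2 := this.enorm
    convert h2 using 2 with z
    by_cases hz : z ∈ Metric.ball c R <;> simp [hz]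
  rw [← lintegral_indicator measurableSet_ball, ← lintegral_add_left_eq_self _ c,
    lintegral_eq_lintegral_polar (by fun_prop)]
  calc ENNReal.ofReal (Real.pi * R ^ 2) * ‖h c‖ₑ
      = ∫⁻ r in Ioo 0 R, ENNReal.ofReal r * (ENNReal.ofReal (2 * Real.pi) * ‖h c‖ₑ) := by
        rw [lintegral_mul_const _ (by fun_prop), lintegral_Ioo_ofReal hR.le, ← mul_assoc,
          ← ENNReal.ofReal_mul (by positivity)]
        congr 2
        ring
    _ ≤ ∫⁻ r in Ioo 0 R, ENNReal.ofReal r * ∫⁻ θ in Ioo (-Real.pi) Real.pi,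
        (Metric.ball c R).indicator (fun z => ‖h z‖ₑ)
          (c + r * Complex.exp (θ * Complex.I)) := by
        refine setLIntegral_mono' measurableSet_Ioo fun r hr => ?_
        gcongr
        refine (enorm_mul_two_pi_le_lintegral_circle hr.1 hr.2 hh).trans_eq ?_
        refine lintegral_congr fun θ => ?_
        rw [indicator_of_mem]
        simp [Complex.norm_exp_ofReal_mul_I, abs_of_pos hr.1, hr.2]
    _ ≤ _ := lintegral_mono_set Ioo_subset_Ioi_self

/-! ### From the seminorm to pointwise growth. -/

theorem ball_subset_carlesonBox {z : ℂ} (hz : ‖z‖ < 1) :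
    ∃ c l : ℝ, 0 < l ∧ l ≤ 1 ∧ l ≤ 4 * (1 - ‖z‖) ∧
      Metric.ball z ((1 - ‖z‖) / 2) ⊆ carlesonBox (arc c l) l := by
  have hpi := Real.pi_gt_three
  -- Away from the boundary the whole disc serves as the box; near it, the arc is centred at `arg
  -- z`.
  rcases le_or_gt (1 / 4) (1 - ‖z‖) with hd | hd
  · refine ⟨0, 1, one_pos, le_rfl, by linarith, fun w hw => ?_⟩
    rw [Metric.mem_ball, dist_eq_norm] at hw
    refine ⟨by simp, by linarith [norm_sub_norm_le w z], Complex.exp (w.arg * Complex.I),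
      ⟨w.arg, by simpa using Complex.abs_arg_le_pi w, rfl⟩, ?_⟩
    rw [Complex.norm_mul_exp_arg_mul_I]
  · refine ⟨z.arg, 4 * (1 - ‖z‖), by linarith, by linarith, le_rfl, fun w hw => ?_⟩
    rw [Metric.mem_ball, dist_eq_norm] at hw
    have hz0 : z ≠ 0 := by
      rintro rfl
      norm_num at hd
    have hzn : 0 < ‖z‖ := norm_pos_iff.2 hz0
    -- Here `‖z‖ > 3/4`, and `(1/2) / (3/4) = 2/3`. The angle between `w` and `z` is the imaginary
    -- part of `log (1 + v)`, of size at most `3/2 * ‖v‖`.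
    have hv : ‖(w - z) / z‖ ≤ 2 / 3 * (1 - ‖z‖) := by
      rw [norm_div, div_le_iff₀ hzn]
      nlinarith
    set v := (w - z) / z with hvdef
    have hw' : w = z * (1 + v) := by
      rw [hvdef]; field_simp; ring
    have hlog := Complex.norm_log_one_add_half_le_self (z := v) (by linarith)
    have harg : |(1 + v).arg| ≤ Real.pi * (4 * (1 - ‖z‖)) := by
      rw [← Complex.log_im]
      have := Complex.abs_im_le_norm (Complex.log (1 + v))
      nlinarith
    refine ⟨by linarith [norm_sub_norm_le z w, norm_sub_rev z w],
      by linarith [norm_sub_norm_le w z], _, ⟨z.arg + (1 + v).arg, ?_, rfl⟩, ?_⟩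
    · simpa using harg
    · nth_rewrite 1 [hw', ← Complex.norm_mul_exp_arg_mul_I z,
        ← Complex.norm_mul_exp_arg_mul_I (1 + v)]
      rw [hw', norm_mul, Complex.ofReal_add, add_mul, Complex.exp_add]
      push_cast
      ring

theorem lintegral_box_le_of_seminorm_lt_top {p lam : ℝ} {g : ℂ → ℂ} (h : seminorm p lam g < ∞) :
    ∃ M : ℝ, 0 ≤ M ∧ ∀ c l : ℝ, 0 < l → l ≤ 1 →
      ∫⁻ z in carlesonBox (arc c l) l,
        ENNReal.ofReal (‖deriv g z‖ ^ 2 * (1 - ‖z‖ ^ 2) ^ p) ∂area ≤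
        ENNReal.ofReal (M * l ^ (p - lam + 1)) := by
  refine ⟨((seminorm p lam g) ^ (2 : ℝ)).toReal, ENNReal.toReal_nonneg, fun c l hl hl1 => ?_⟩
  have h1 := le_iSup_of_le (α := ℝ≥0∞) (f := fun c : ℝ => ⨆ (l : ℝ) (_ : 0 < l ∧ l ≤ 1),
    (ENNReal.ofReal (1 / l ^ (p - lam + 1)) *
      ∫⁻ z in carlesonBox (arc c l) l,
        ENNReal.ofReal (‖deriv g z‖ ^ 2 * (1 - ‖z‖ ^ 2) ^ p) ∂area) ^ (1 / 2 : ℝ)) c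
    (le_iSup₂_of_le l ⟨hl, hl1⟩ le_rfl)
  change _ ≤ seminorm p lam g at h1
  have h2 := ENNReal.rpow_le_rpow h1 (zero_le_two (α := ℝ))
  rw [← ENNReal.rpow_mul] at h2
  rw [show (1 / 2 : ℝ) * 2 = 1 by norm_num, ENNReal.rpow_one, one_div] at h2
  have hlp : 0 < l ^ (p - lam + 1) := Real.rpow_pos_of_pos hl _
  rw [ENNReal.ofReal_mul ENNReal.toReal_nonneg, ENNReal.ofReal_toReal
    (ENNReal.rpow_lt_top_of_nonneg zero_le_two h.ne).ne]
  rw [ENNReal.ofReal_inv_of_pos hlp, mul_comm, ← div_eq_mul_inv, ENNReal.div_le_iff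
    (by simpa using hlp) ENNReal.ofReal_ne_top] at h2
  exact h2

theorem norm_deriv_sq_le_of_mem_space {p lam : ℝ} (hp : 0 ≤ p) (hlam : lam ≤ p)
    {g : ℂ → ℂ} (hg : g ∈ space p lam) :
    ∃ C : ℝ, 0 ≤ C ∧ ∀ z : ℂ, ‖z‖ < 1 → ‖deriv g z‖ ^ 2 ≤ C * (1 - ‖z‖) ^ (-(1 + lam)) := by
  obtain ⟨M, hM, hbox⟩ := lintegral_box_le_of_seminorm_lt_top hg.2
  refine ⟨M * 4 ^ (p - lam + 1) * 2 ^ (p + 2), by positivity, fun z hz => ?_⟩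
  obtain ⟨c, l, hl, hl1, hl4, hsub⟩ := ball_subset_carlesonBox hz
  set δ := 1 - ‖z‖ with hδ
  have hδ0 : 0 < δ := by linarith
  have hball : ∀ w ∈ Metric.ball z (δ / 2), δ / 2 ≤ 1 - ‖w‖ := fun w hw => by
    rw [Metric.mem_ball, dist_eq_norm] at hw
    linarith [norm_sub_norm_le w z]
  -- The square of `g'` is holomorphic, so its sub-mean value inequality is the one for `|g'|²`.
  have hdiff : DifferentiableOn ℂ (fun w => deriv g w ^ 2) (Metric.ball z (δ / 2)) := fun w hw =>
    ((hg.1 w (by simpa using by linarith [hball w hw])).deriv.differentiableAt.pow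
      2).differentiableWithinAt
  have h1 := enorm_mul_le_lintegral_ball (half_pos hδ0) hdiff
  have h2 : ENNReal.ofReal ((δ / 2) ^ p) * ∫⁻ w in Metric.ball z (δ / 2), ‖deriv g w ^ 2‖ₑ ≤
      ∫⁻ w in Metric.ball z (δ / 2), ENNReal.ofReal (‖deriv g w‖ ^ 2 * (1 - ‖w‖ ^ 2) ^ p) := by
    rw [← lintegral_const_mul' _ _ ENNReal.ofReal_ne_top]
    refine setLIntegral_mono' measurableSet_ball fun w hw => ?_
    have := hball w hw
    rw [← ofReal_norm, ← ENNReal.ofReal_mul (by positivity), norm_pow, mul_comm]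
    gcongr
    nlinarith [norm_nonneg w]
  have h3 := (lintegral_mono_set hsub).trans (hbox c l hl hl1)
  rw [area, Measure.restrict_smul, lintegral_smul_measure, smul_eq_mul] at h3
  have h4 := (mul_le_mul_right ((mul_le_mul_right h1 _).trans h2)
    (ENNReal.ofReal (1 / Real.pi))).trans h3
  rw [← ofReal_norm, norm_pow, ← ENNReal.ofReal_mul (by positivity),
    ← ENNReal.ofReal_mul (by positivity), ← ENNReal.ofReal_mul (by positivity),
    ENNReal.ofReal_le_ofReal_iff (by positivity)] at h4
  have h5 : l ^ (p - lam + 1) ≤ (4 * δ) ^ (p - lam + 1) :=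
    Real.rpow_le_rpow hl.le hl4 (by linarith)
  have h6 : (δ / 2) ^ (p + 2) * ‖deriv g z‖ ^ 2 ≤ M * (4 * δ) ^ (p - lam + 1) := by
    refine le_trans (le_of_eq ?_) (h4.trans (mul_le_mul_of_nonneg_left h5 hM))
    rw [Real.rpow_add (by positivity), Real.rpow_two]
    field_simp
  rw [Real.mul_rpow (by norm_num) hδ0.le, Real.div_rpow hδ0.le (by norm_num),
    show p - lam + 1 = (p + 2) + (-(1 + lam)) by ring,
    Real.rpow_add hδ0 (p + 2) (-(1 + lam))] at h6
  rw [show p - lam + 1 = (p + 2) + (-(1 + lam)) by ring]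
  have hA : 0 < δ ^ (p + 2) := by positivity
  refine le_of_mul_le_mul_left ?_ hA
  rw [div_mul_eq_mul_div, div_le_iff₀ (by positivity)] at h6
  exact h6.trans_eq (by ring)

/-! ### From pointwise growth back to the seminorm. -/

theorem abs_arg_le_of_mem_carlesonBox {c l : ℝ} (hl1 : l ≤ 1) {z : ℂ}
    (hz : z ∈ carlesonBox (arc c l) l) :
    |(Complex.exp (-c * Complex.I) * z).arg| ≤ Real.pi * l := by
  obtain ⟨-, -, _, ⟨θ, hθ, rfl⟩, hzθ⟩ := hz
  have hpi := Real.pi_pos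
  have hl0 : 0 ≤ Real.pi * l := (abs_nonneg _).trans hθ
  have hlp : Real.pi * l ≤ Real.pi := by nlinarith
  have h1 : Complex.exp (-c * Complex.I) * z =
      ‖z‖ * Complex.exp ((θ - c : ℝ) * Complex.I) := by
    nth_rewrite 1 [hzθ]
    rw [mul_left_comm, ← Complex.exp_add]
    push_cast
    ring_nf
  rw [h1]
  rcases (norm_nonneg z).eq_or_lt with h0 | h0
  · rw [← h0]; simpa using hl0
  rw [Complex.arg_real_mul _ h0]
  have habs := abs_le.1 hθ
  -- The endpoint `-π`, where `arg` jumps to `π`, is reached only if `l` is `1`, and then the bound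
  -- is trivial.
  rcases eq_or_lt_of_le (show -Real.pi ≤ θ - c by linarith) with he | hlt
  · have : Real.pi ≤ Real.pi * l := by linarith
    exact (Complex.abs_arg_le_pi _).trans this
  · rw [Complex.exp_mul_I, Complex.arg_cos_add_sin_mul_I ⟨hlt, by linarith⟩]
    exact hθ

theorem lintegral_rpow_Ioo {a l : ℝ} (ha : -1 < a) (hl : 0 ≤ l) :
    ∫⁻ r in Ioo (1 - l) 1, ENNReal.ofReal ((1 - r) ^ a) =
      ENNReal.ofReal (l ^ (a + 1) / (a + 1)) := by
  have hi : IntervalIntegrable (fun r : ℝ => (1 - r) ^ a) volume (1 - l) 1 := by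
    have := (intervalIntegral.intervalIntegrable_rpow' (a := l) (b := 0) ha).comp_sub_left 1
    simpa using this
  rw [restrict_Ioo_eq_restrict_Ioc, ← ofReal_integral_eq_lintegral_ofReal,
    ← intervalIntegral.integral_of_le (by linarith),
    intervalIntegral.integral_comp_sub_left (fun x : ℝ => x ^ a), integral_rpow (Or.inl ha)]
  · simp [Real.zero_rpow (show a + 1 ≠ 0 by linarith)]
  · exact (intervalIntegrable_iff_integrableOn_Ioc_of_le (by linarith)).1 hi
  · filter_upwards [ae_restrict_mem measurableSet_Ioc] with r hr
    exact Real.rpow_nonneg (by linarith [hr.2]) _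

/-- Rotating the arc to centre `0` puts the box inside the measurable polar rectangle `T`. The
angular integral gives `2πl`, the radial one `l ^ (a + 1) / (a + 1)`, with the Jacobian `r` bounded
by `1`. -/
theorem lintegral_carlesonBox_rpow_le {a c l : ℝ} (ha : -1 < a) (hl : 0 < l) (hl1 : l ≤ 1) :
    ∫⁻ z in carlesonBox (arc c l) l, ENNReal.ofReal ((1 - ‖z‖) ^ a) ≤
      ENNReal.ofReal (2 * Real.pi / (a + 1) * l ^ (a + 2)) := by
  set T : Set ℂ := {w | ‖w‖ ∈ Ico (1 - l) 1 ∧ |w.arg| ≤ Real.pi * l}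
  have hTm : MeasurableSet T := (measurable_norm measurableSet_Ico).inter
    (measurableSet_le (continuous_abs.measurable.comp Complex.measurable_arg) measurable_const)
  set F : ℂ → ℝ≥0∞ := T.indicator fun z => ENNReal.ofReal ((1 - ‖z‖) ^ a) with hF
  have hFm : Measurable F :=
    (show Measurable fun z : ℂ => ENNReal.ofReal ((1 - ‖z‖) ^ a) by fun_prop).indicator hTm
  set u : Circle := Circle.exp (-c) with hu
  have hun : ∀ z, rotation u z = Complex.exp (-c * Complex.I) * z := fun z => by
    rw [rotation_apply, hu, Circle.coe_exp]; push_cast; rfl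
  calc ∫⁻ z in carlesonBox (arc c l) l, ENNReal.ofReal ((1 - ‖z‖) ^ a)
      ≤ ∫⁻ z in carlesonBox (arc c l) l, F (rotation u z) := by
        refine setLIntegral_mono (hFm.comp (rotation u).continuous.measurable) fun z hz => ?_
        rw [hF, indicator_of_mem, LinearIsometryEquiv.norm_map]
        refine ⟨?_, ?_⟩
        · rw [LinearIsometryEquiv.norm_map]
          exact ⟨hz.1, hz.2.1⟩
        · rw [hun]
          exact abs_arg_le_of_mem_carlesonBox hl1 hz
    _ ≤ ∫⁻ z, F (rotation u z) := setLIntegral_le_lintegral _ _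
    _ = ∫⁻ z, F z := (rotation u).measurePreserving.lintegral_comp hFm
    _ = _ := lintegral_eq_lintegral_polar hFm
    _ ≤ ∫⁻ r in Ioi (0 : ℝ), (Ioo (1 - l) 1).indicator (fun r => ENNReal.ofReal ((1 - r) ^ a) *
          ENNReal.ofReal (2 * Real.pi * l)) r := by
        refine lintegral_mono_ae ?_
        filter_upwards [ae_restrict_mem measurableSet_Ioi,
          ae_restrict_of_ae (Measure.ae_ne volume (1 - l))] with r hr hne
        have hr0 : (0 : ℝ) < r := hr
        have hnorm : ∀ θ : ℝ, ‖(r : ℂ) * Complex.exp (θ * Complex.I)‖ = r := fun θ => by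
          simp [Complex.norm_exp_ofReal_mul_I, abs_of_pos hr0]
        by_cases hrI : r ∈ Ioo (1 - l) 1
        · rw [indicator_of_mem hrI]
          have hin : ∫⁻ θ in Ioo (-Real.pi) Real.pi, F (r * Complex.exp (θ * Complex.I)) ≤
              ENNReal.ofReal ((1 - r) ^ a) * ENNReal.ofReal (2 * Real.pi * l) := by
            calc _ ≤ ∫⁻ θ in Ioo (-Real.pi) Real.pi, (Icc (-(Real.pi * l)) (Real.pi * l)).indicator
                  (fun _ => ENNReal.ofReal ((1 - r) ^ a)) θ := by
                  refine setLIntegral_mono' measurableSet_Ioo fun θ hθ => ?_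
                  by_cases hmem : (r : ℂ) * Complex.exp (θ * Complex.I) ∈ T
                  · have harg := hmem.2
                    rw [Complex.arg_real_mul _ hr0, Complex.exp_mul_I,
                      Complex.arg_cos_add_sin_mul_I ⟨hθ.1, hθ.2.le⟩] at harg
                    rw [hF, indicator_of_mem hmem, indicator_of_mem (mem_Icc.2 (abs_le.1 harg)), hnorm]
                  · rw [hF, indicator_of_notMem hmem]
                    exact zero_le
              _ ≤ ∫⁻ θ, (Icc (-(Real.pi * l)) (Real.pi * l)).indicator
                  (fun _ => ENNReal.ofReal ((1 - r) ^ a)) θ := setLIntegral_le_lintegral _ _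
              _ = _ := by
                rw [lintegral_indicator_const measurableSet_Icc, Real.volume_Icc]
                congr 2; ring
          calc _ ≤ 1 * _ := mul_le_mul' (by simpa using hrI.2.le) hin
            _ = _ := one_mul _
        · have : ∀ θ : ℝ, F (r * Complex.exp (θ * Complex.I)) = 0 := fun θ => by
            refine indicator_of_notMem (fun hmem => hrI ?_) _
            have := hmem.1
            rw [hnorm] at this
            exact ⟨lt_of_le_of_ne this.1 (Ne.symm hne), this.2⟩
          simp [this]
    _ ≤ ∫⁻ r, (Ioo (1 - l) 1).indicator (fun r => ENNReal.ofReal ((1 - r) ^ a) *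
          ENNReal.ofReal (2 * Real.pi * l)) r := setLIntegral_le_lintegral _ _
    _ = _ := by
        rw [lintegral_indicator measurableSet_Ioo, lintegral_mul_const _ (by fun_prop),
          lintegral_rpow_Ioo ha hl.le, ← ENNReal.ofReal_mul
            (div_nonneg (Real.rpow_nonneg hl.le _) (by linarith)),
          show a + 2 = a + 1 + 1 by ring, Real.rpow_add_one hl.ne' (a + 1)]
        congr 1
        ring

theorem mem_space_of_norm_deriv_sq_le {p lam C : ℝ} (hp : 0 ≤ p) (hlam : lam < p) (hC : 0 ≤ C)
    {g : ℂ → ℂ} (hg : AnalyticOnNhd ℂ g (Metric.ball 0 1))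
    (hb : ∀ z : ℂ, ‖z‖ < 1 → ‖deriv g z‖ ^ 2 ≤ C * (1 - ‖z‖) ^ (-(1 + lam))) :
    g ∈ space p lam := by
  refine ⟨hg, ?_⟩
  -- Integrability up to the circle needs `a > -1`, which is `lam < p`.
  set a := p - lam - 1 with ha
  set K := C * 2 ^ p * (2 / (a + 1)) with hK
  have ha1 : 0 < a + 1 := by linarith
  refine lt_of_le_of_lt (b := ENNReal.ofReal K ^ (1 / 2 : ℝ)) ?_
    (ENNReal.rpow_lt_top_of_nonneg (by norm_num) ENNReal.ofReal_ne_top)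
  refine iSup_le fun c => iSup₂_le fun l hl => ?_
  refine ENNReal.rpow_le_rpow ?_ (by norm_num)
  have h1 : ∫⁻ z in carlesonBox (arc c l) l,
      ENNReal.ofReal (‖deriv g z‖ ^ 2 * (1 - ‖z‖ ^ 2) ^ p) ≤
      ENNReal.ofReal (C * 2 ^ p) *
        ENNReal.ofReal (2 * Real.pi / (a + 1) * l ^ (a + 2)) := by
    calc _ ≤ ∫⁻ z in carlesonBox (arc c l) l,
        ENNReal.ofReal (C * 2 ^ p) * ENNReal.ofReal ((1 - ‖z‖) ^ a) := by
          refine setLIntegral_mono (by fun_prop) fun z hz => ?_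
          have hz1 : 0 < 1 - ‖z‖ := sub_pos.2 hz.2.1
          rw [← ENNReal.ofReal_mul (by positivity)]
          refine ENNReal.ofReal_le_ofReal ?_
          have h2 : (1 - ‖z‖ ^ 2) ^ p ≤ (2 * (1 - ‖z‖)) ^ p :=
            Real.rpow_le_rpow (by nlinarith [norm_nonneg z]) (by nlinarith [norm_nonneg z]) hp
          refine (mul_le_mul (hb z hz.2.1) h2
            (Real.rpow_nonneg (by nlinarith [norm_nonneg z]) _) (by positivity)).trans_eq ?_
          rw [Real.mul_rpow zero_le_two hz1.le, ha,
            show p - lam - 1 = p + -(1 + lam) by ring, Real.rpow_add hz1]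
          ring
      _ ≤ _ := by
          rw [lintegral_const_mul _ (by fun_prop)]
          gcongr
          exact lintegral_carlesonBox_rpow_le (by linarith) hl.1 hl.2
  rw [area, Measure.restrict_smul, lintegral_smul_measure, smul_eq_mul]
  have hlp : 0 < l ^ (a + 2) := Real.rpow_pos_of_pos hl.1 _
  rw [show p - lam + 1 = a + 2 by ring]
  refine (mul_le_mul_right (mul_le_mul_right h1 _) _).trans_eq ?_
  rw [← ENNReal.ofReal_mul (by positivity), ← ENNReal.ofReal_mul (by positivity),
    ← ENNReal.ofReal_mul (by positivity)]
  congr 1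
  rw [hK]
  field_simp

theorem space_subset_space {p q lam : ℝ} (hp : 0 ≤ p) (hq : 0 ≤ q) (hlp : lam ≤ p)
    (hlq : lam < q) : space p lam ⊆ space q lam := fun _ hg =>
  let ⟨_, hC, hb⟩ := norm_deriv_sq_le_of_mem_space hp hlp hg
  mem_space_of_norm_deriv_sq_le hq hlq hC hg.1 hb

end BlochMorrey

theorem mainTheorem10 (p q lam : ℝ) (hlam0 : 0 < lam) (hlam1 : lam < 1)
    (hp : 1 < p) (hpq : p < q) :
    BlochMorrey.space p lam = BlochMorrey.space q lam := by
  apply Set.Subset.antisymm <;> apply BlochMorrey.space_subset_space <;> linarith
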